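/- Let $W$ be a binary memoryless symmetric (BMS) channel: a binary-input channel with an arbitrary measurable output alphabet $\mathcal Y$ for which some measurable permutation $\pi$ of $\mathcal Y$ (with measurable inverse) exchanges the two output laws $W(\cdot\mid 0)$ and $W(\cdot\mid 1)$. Let $C(W)$ denote its capacity in bits. For an integer $r\ge 1$ let $W^r$ be the $r$-repetition channel, which sends its input bit independently through $r$ copies of $W$ and outputs the $r$-tuple of results. Let $n\ge 1$ be a block length, $\beta\in[0,1]$, and let $D$ be a set of permitted repetition lengths (e.g. the divisors of $n$, or all positive integers). Let $r_\beta=r_\beta(W)$ denote the largest integer $r\ge1$ in $D$ with $$\frac{n}{r}\,C(W^{r})\ \ge\ \beta\, n\, C(W).$$ This maximum exists whenever $1\in D$ and either $D$ is finite or $\beta\,C(W)>0$. **Theorem (Upper Bound on Repetition Length for any BMS).** Among all BMS channels with the same capacity, the binary erasure channel has the largest repetition length: if $W$ is a BMS channel with capacity $C$, then $0\le C\le 1$, $\mathrm{BEC}(1-C)$ is a BMS channel with capacity $C$, and $r_\beta(W)\le r_\beta(\mathrm{BEC}(1-C))$ for all $n$, $\beta$ and $D$ for which the two maxima exist. Moreover,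 for $\beta<1$ and $\kappa=nC$, every BMS channel with capacity $C$ satisfies, whenever $r_\beta$ exists, $$\frac{n}{r_\beta}\ \ge\ \frac{\kappa}{2(1-\beta)}\,\beta^2\,\bigl(1+\mathcal O(C)\bigr),$$ in the following sense: there is an absolute constant $K>0$ (independent of $W$, $\mathcal Y$, $n$, $D$ and $\beta$) such that $$\frac{n}{r_\beta}\ \ge\ \frac{\kappa}{2(1-\beta)}\,\beta^2\Bigl(1-\frac{K}{1-\beta}\,C\Bigr).$$ -/

import Mathlib

open MeasureTheory ProbabilityTheory
open scoped ENNReal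

noncomputable section

/-- The mutual information `I(X;Y)`, in nats, between the input `X` of law `p` and the output `Y`
of a binary-input channel `W`: the Kullback-Leibler divergence between the joint law and the
product of the two marginal laws. -/
def mutualInformation {Y : Type*} [MeasurableSpace Y] (p : Measure Bool) (W : Kernel Bool Y) :
    ℝ≥0∞ :=
  InformationTheory.klDiv (p.compProd W) (p.prod (p.bind W))

/-- The Shannon capacity, in bits per channel use, of a binary-input memoryless channel: the
supremum of the mutual information over all input laws (each of these is at most one bit). -/
def capacity {Y : Type*} [MeasurableSpace Y] (W : Kernel Bool Y) : ℝ :=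
  (⨆ (p : Measure Bool) (_ : IsProbabilityMeasure p), mutualInformation p W).toReal / Real.log 2

/-- Binary memoryless symmetric channels, with an arbitrary measurable output alphabet: some
permutation of the outputs exchanges the output laws of the two inputs. (If the permutation is an
involution, either of the two equations implies the other.) -/
structure IsBMS {Y : Type*} [MeasurableSpace Y] (W : Kernel Bool Y) : Prop where
  markov : IsMarkovKernel W
  symmetric : ∃ π : Y ≃ᵐ Y, (W false).map π = W true ∧ (W true).map π = W false

/-- The `r`-repetition channel `W^r`: the input bit is sent through `r` independent copies of `W`,
and the output is the `r`-tuple of outcomes. -/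
def repetitionChannel {Y : Type*} [MeasurableSpace Y] (W : Kernel Bool Y) (r : ℕ) :
    Kernel Bool (Fin r → Y) where
  toFun x := Measure.pi fun _ => W x
  measurable' := measurable_of_countable _

/-- The outputs of the erasure channel form a discrete alphabet. -/
instance : MeasurableSpace (Option Bool) := ⊤

/-- The binary erasure channel with erasure probability `ε ∈ [0, 1]`: the output is the erasure
symbol `none` with probability `ε`, and the transmitted bit otherwise. -/
def BEC (ε : ℝ) : Kernel Bool (Option Bool) where
  toFun x := ENNReal.ofReal ε • Measure.dirac none + ENNReal.ofReal (1 - ε) • Measure.dirac (some x)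
  measurable' := measurable_of_countable _

/-- The repetition lengths `r ≥ 1`, among the permitted ones `D` (for instance the divisors of the
block length `n`, or all integers), for which `(n / r) C(W^r) ≥ β n C(W)`. -/
def admissibleLengths (D : Set ℕ) (n : ℕ) (β : ℝ) {Y : Type*} [MeasurableSpace Y]
    (W : Kernel Bool Y) : Set ℕ :=
  {r | r ∈ D ∧ 1 ≤ r ∧
    β * (n * capacity W) ≤ (n : ℝ) / r * capacity (repetitionChannel W r)}

/-- `r` is the largest repetition length `r_β` of the channel `W`, at block length `n`. -/
def IsLargestRepetition (D : Set ℕ) (n : ℕ) (β : ℝ) {Y : Type*} [MeasurableSpace Y]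
    (W : Kernel Bool Y) (r : ℕ) : Prop :=
  IsGreatest (admissibleLengths D n β W) r

end

/-! Relative to the mean `M` of its two output laws, a BMS channel has densities `1 + t` and `1 -
t`, where `t` is symmetrically distributed. It is thus a mixture of binary symmetric channels, and
uniform input is optimal, so its capacity in nats is the mean of `h(t)`, with `h` =
`bscInformation`.

Send one bit through two independent such channels, with parameters `s` and `t`. The chain rule
`I(X; Y₁, Y₂) = I(X; Y₁) + I(X; Y₂) - I(Y₁; Y₂)` shows that the loss against the sum of the
capacities is the mean of `h(st)` (`capacity_prod`). Since `h` is a power series in `t ^ 2` with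
nonnegative coefficients of sum `log 2`, Chebyshev's sum inequality gives `h(s) h(t) ≤ log 2 *
h(st)` (`bscInformation_mul_le`), with equality if `s` is `0` or `±1`. Averaging, `1 - C` is
supermultiplicative, and multiplicative when one factor is an erasure channel. By induction `C(W^r)
≤ 1 - (1 - C)^r`, with equality for the BEC. Hence every length admissible for `W` is admissible for
the BEC.

For the explicit bound, an admissible `r` satisfies `β r C ≤ 1 - (1 - C)^r`. Writing the power as
`exp (-x)` with `x` close to `r C` reduces the claim to a one-variable inequality
(`repetition_bound`). -/

/-! ### The information function of the binary symmetric channel. -/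

/-- The information, in nats, that a binary symmetric channel with crossover probability
`(1 - t) / 2` gives about a uniform input. -/
noncomputable def bscInformation (t : ℝ) : ℝ :=
  ((1 + t) * Real.log (1 + t) + (1 - t) * Real.log (1 - t)) / 2

theorem bscInformation_neg (t : ℝ) : bscInformation (-t) = bscInformation t := by
  simp only [bscInformation, sub_neg_eq_add, ← sub_eq_add_neg]; ring

theorem bscInformation_zero : bscInformation 0 = 0 := by simp [bscInformation]

theorem bscInformation_one : bscInformation 1 = Real.log 2 := by
  norm_num [bscInformation]

theorem continuous_bscInformation : Continuous bscInformation := by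
  have h1 : Continuous fun t : ℝ => (1 + t) * Real.log (1 + t) :=
    Real.continuous_mul_log.comp (continuous_const.add continuous_id)
  have h2 : Continuous fun t : ℝ => (1 - t) * Real.log (1 - t) :=
    Real.continuous_mul_log.comp (continuous_const.sub continuous_id)
  exact (h1.add h2).div_const 2

theorem sub_one_le_mul_log {x : ℝ} (hx : 0 ≤ x) : x - 1 ≤ x * Real.log x := by
  have := InformationTheory.klFun_nonneg hx
  rw [InformationTheory.klFun_apply] at this
  linarith

theorem bscInformation_nonneg {t : ℝ} (ht : |t| ≤ 1) : 0 ≤ bscInformation t := by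
  obtain ⟨h1, h2⟩ := abs_le.1 ht
  have := sub_one_le_mul_log (x := 1 + t) (by linarith)
  have := sub_one_le_mul_log (x := 1 - t) (by linarith)
  unfold bscInformation
  linarith

theorem bscInformation_le_log_two {t : ℝ} (ht : |t| ≤ 1) : bscInformation t ≤ Real.log 2 := by
  obtain ⟨h1, h2⟩ := abs_le.1 ht
  have key : ∀ x : ℝ, 0 ≤ x → x ≤ 2 → x * Real.log x ≤ x * Real.log 2 := by
    intro x hx hx2
    rcases hx.eq_or_lt with rfl | hx
    · simp
    · exact mul_le_mul_of_nonneg_left (Real.log_le_log hx hx2) hx.le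
  have := key (1 + t) (by linarith) (by linarith)
  have := key (1 - t) (by linarith) (by linarith)
  unfold bscInformation
  linarith

/-- Combine the series of `log (1 - t ^ 2)` and of `log (1 + t) - log (1 - t)`. What matters later
is that only even powers occur, with nonnegative coefficients. -/
theorem hasSum_bscInformation {t : ℝ} (ht : |t| < 1) :
    HasSum (fun k : ℕ => (1 / (2 * (k : ℝ) + 1) - 1 / (2 * k + 2)) * (t ^ 2) ^ (k + 1))
      (bscInformation t) := by
  have ht2 : |t ^ 2| < 1 := by
    rw [abs_pow]; exact pow_lt_one₀ (abs_nonneg t) ht two_ne_zero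
  have h1 := (Real.hasSum_pow_div_log_of_abs_lt_one ht2).mul_left (-1 / 2)
  have h2 := (Real.hasSum_log_sub_log_of_abs_lt_one ht).mul_left (t / 2)
  obtain ⟨h3, h4⟩ := abs_lt.1 ht
  have hterm : ∀ k : ℕ, (1 / (2 * (k : ℝ) + 1) - 1 / (2 * k + 2)) * (t ^ 2) ^ (k + 1) =
      -1 / 2 * ((t ^ 2) ^ (k + 1) / (k + 1)) +
        t / 2 * (2 * (1 / (2 * k + 1)) * t ^ (2 * k + 1)) := by
    intro k
    have : (k : ℝ) + 1 ≠ 0 := by positivity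
    have : 2 * (k : ℝ) + 1 ≠ 0 := by positivity
    have e : (t ^ 2) ^ (k + 1) = t ^ (2 * k + 1) * t := by ring
    rw [e, show 2 * (k : ℝ) + 2 = 2 * (k + 1) by ring]
    field_simp
    ring
  have hval : bscInformation t =
      -1 / 2 * -Real.log (1 - t ^ 2) + t / 2 * (Real.log (1 + t) - Real.log (1 - t)) := by
    have : Real.log (1 - t ^ 2) = Real.log (1 + t) + Real.log (1 - t) := by
      rw [← Real.log_mul (by linarith) (by linarith)]; congr 1; ring
    rw [this, bscInformation]
    ring
  rw [funext hterm, hval]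
  exact h1.add h2

/-! ### The product inequality and the pointwise chain rule. -/

/-- Chebyshev's sum inequality with weights. -/
theorem HasSum.mul_le_mul_of_antitone {w a b : ℕ → ℝ} {W A B S : ℝ} (hw : ∀ k, 0 ≤ w k)
    (ha : Antitone a) (hb : Antitone b) (hW : HasSum w W) (hA : HasSum (fun k => w k * a k) A)
    (hB : HasSum (fun k => w k * b k) B) (hS : HasSum (fun k => w k * (a k * b k)) S) :
    A * B ≤ W * S := by
  refine le_of_tendsto_of_tendsto' (hA.tendsto_sum_nat.mul hB.tendsto_sum_nat)
    (hW.tendsto_sum_nat.mul hS.tendsto_sum_nat) fun n => ?_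
  -- For partial sums, expanding this double sum gives twice the difference of the two sides.
  have h : 0 ≤ ∑ i ∈ Finset.range n, ∑ j ∈ Finset.range n,
      w i * w j * ((a i - a j) * (b i - b j)) := by
    refine Finset.sum_nonneg fun i _ => Finset.sum_nonneg fun j _ =>
      mul_nonneg (mul_nonneg (hw i) (hw j)) ?_
    rcases le_total i j with hij | hij
    · exact mul_nonneg (sub_nonneg.2 (ha hij)) (sub_nonneg.2 (hb hij))
    · exact mul_nonneg_of_nonpos_of_nonpos (sub_nonpos.2 (ha hij)) (sub_nonpos.2 (hb hij))
  have e : ∀ i j, w i * w j * ((a i - a j) * (b i - b j)) =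
      w i * (a i * b i) * w j + w i * (w j * (a j * b j))
        - (w i * a i) * (w j * b j) - (w i * b i) * (w j * a j) := by intros; ring
  simp only [e, Finset.sum_add_distrib, Finset.sum_sub_distrib, ← Finset.sum_mul_sum] at h
  linarith

/-- Chebyshev's inequality with the terms of the series at `u` as weights, applied to the decreasing
sequences of even powers of `s` and `t`. The factor `u` keeps every argument inside the interval of
convergence. -/
theorem bscInformation_mul_le_of_lt {u s t : ℝ} (hu : |u| < 1) (hs : |s| ≤ 1) (ht : |t| ≤ 1) :
    bscInformation (u * s) * bscInformation (u * t) ≤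
      bscInformation u * bscInformation (u * (s * t)) := by
  have lt : ∀ x : ℝ, |x| ≤ 1 → |u * x| < 1 := fun x hx => by
    rw [abs_mul]; exact (mul_le_of_le_one_right (abs_nonneg u) hx).trans_lt hu
  have anti : ∀ x : ℝ, |x| ≤ 1 → Antitone fun k : ℕ => (x ^ 2) ^ (k + 1) := fun x hx i j hij =>
    pow_le_pow_of_le_one (sq_nonneg x) ((sq_le_one_iff_abs_le_one x).2 hx) (by omega)
  have hst : |s * t| ≤ 1 := by
    rw [abs_mul]; exact mul_le_one₀ hs (abs_nonneg t) ht
  refine HasSum.mul_le_mul_of_antitone (fun k => ?_) (anti s hs) (anti t ht)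
    (hasSum_bscInformation hu) ?_ ?_ ?_
  · refine mul_nonneg (sub_nonneg.2 ?_) (by positivity)
    exact one_div_le_one_div_of_le (by positivity) (by linarith)
  · simpa only [mul_pow, mul_assoc] using hasSum_bscInformation (lt s hs)
  · simpa only [mul_pow, mul_assoc] using hasSum_bscInformation (lt t ht)
  · simpa only [mul_pow, mul_assoc] using hasSum_bscInformation (lt _ hst)

/-- The limit `u → 1`, where the total weight becomes `log 2`. -/
theorem bscInformation_mul_le {s t : ℝ} (hs : |s| ≤ 1) (ht : |t| ≤ 1) :
    bscInformation s * bscInformation t ≤ Real.log 2 * bscInformation (s * t) := by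
  have c := continuous_bscInformation
  have L : Continuous fun u : ℝ => bscInformation (u * s) * bscInformation (u * t) := by fun_prop
  have R : Continuous fun u : ℝ => bscInformation u * bscInformation (u * (s * t)) := by fun_prop
  have l := (L.tendsto 1).mono_left (nhdsWithin_le_nhds (s := Set.Ioo (-1) 1))
  have r := (R.tendsto 1).mono_left (nhdsWithin_le_nhds (s := Set.Ioo (-1) 1))
  simp only [one_mul, bscInformation_one] at l r
  have : (nhdsWithin (1 : ℝ) (Set.Ioo (-1) 1)).NeBot :=
    right_nhdsWithin_Ioo_neBot (by norm_num)
  refine le_of_tendsto_of_tendsto l r ?_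
  filter_upwards [self_mem_nhdsWithin] with u hu
  exact bscInformation_mul_le_of_lt (abs_lt.2 hu) hs ht

/-- The pointwise form of `I(X; Y₁, Y₂) = I(X; Y₁) + I(X; Y₂) - I(Y₁; Y₂)`. -/
theorem mul_bscInformation_div {s t : ℝ} (hs : |s| ≤ 1) (ht : |t| ≤ 1) :
    (1 + s * t) * bscInformation ((s + t) / (1 + s * t)) =
      bscInformation s + bscInformation t
        + t * (((1 + s) * Real.log (1 + s) - (1 - s) * Real.log (1 - s)) / 2)
        + s * (((1 + t) * Real.log (1 + t) - (1 - t) * Real.log (1 - t)) / 2)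
        - (1 + s * t) * Real.log (1 + s * t) := by
  have logmul : ∀ x y : ℝ, x * y * Real.log (x * y) =
      y * (x * Real.log x) + x * (y * Real.log y) := by
    intro x y
    have := Real.negMulLog_mul x y
    simp only [Real.negMulLog] at this
    linarith
  have logdiv : ∀ x c : ℝ, 0 < c → c * (x / c * Real.log (x / c)) =
      x * Real.log x - x * Real.log c := by
    intro x c hc
    rcases eq_or_ne x 0 with rfl | hx
    · simp
    · rw [Real.log_div hx hc.ne']; field_simp
  have hst : |s * t| ≤ 1 := by
    rw [abs_mul]; exact mul_le_one₀ hs (abs_nonneg t) ht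
  have e1 := logmul (1 + s) (1 + t)
  have e2 := logmul (1 - s) (1 - t)
  -- The nonnegative numbers `(1 + s)(1 + t)` and `(1 - s)(1 - t)` add up to `2 (1 + st)`, so both
  -- vanish when the denominator does.
  rcases (show 0 ≤ 1 + s * t by linarith [(abs_le.1 hst).1]).eq_or_lt with h | h
  · obtain ⟨h1, h2⟩ := abs_le.1 hs
    obtain ⟨h3, h4⟩ := abs_le.1 ht
    have n1 : 0 ≤ (1 + s) * (1 + t) := mul_nonneg (by linarith) (by linarith)
    have n2 : 0 ≤ (1 - s) * (1 - t) := mul_nonneg (by linarith) (by linarith)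
    have z1 : (1 + s) * (1 + t) = 0 := by linarith
    have z2 : (1 - s) * (1 - t) = 0 := by linarith
    rw [← h]
    rw [z1] at e1
    rw [z2] at e2
    unfold bscInformation
    simp only [zero_mul] at e1 e2 ⊢
    linarith
  · have f1 : 1 + (s + t) / (1 + s * t) = (1 + s) * (1 + t) / (1 + s * t) := by
      field_simp; ring
    have f2 : 1 - (s + t) / (1 + s * t) = (1 - s) * (1 - t) / (1 + s * t) := by
      field_simp; ring
    have g1 := logdiv ((1 + s) * (1 + t)) _ h
    have g2 := logdiv ((1 - s) * (1 - t)) _ h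
    rw [e1] at g1
    rw [e2] at g2
    rw [bscInformation, f1, f2, mul_div_assoc', mul_add, g1, g2]
    unfold bscInformation
    ring

/-! ### Capacity in terms of a symmetric density. -/

theorem klDiv_withDensity_ofReal {α : Type*} [MeasurableSpace α] (μ : Measure α) {f g : α → ℝ}
    (hf : Measurable f) (hg : Measurable g) (hf0 : ∀ a, 0 ≤ f a) (hg0 : ∀ a, 0 ≤ g a)
    (hfg : ∀ᵐ a ∂μ, g a = 0 → f a = 0)
    [IsFiniteMeasure (μ.withDensity fun a => ENNReal.ofReal (f a))]
    [IsFiniteMeasure (μ.withDensity fun a => ENNReal.ofReal (g a))] :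
    InformationTheory.klDiv (μ.withDensity fun a => ENNReal.ofReal (f a))
      (μ.withDensity fun a => ENNReal.ofReal (g a)) =
      ∫⁻ a, ENNReal.ofReal (g a * InformationTheory.klFun (f a / g a)) ∂μ := by
  have hgm : Measurable fun a => ENNReal.ofReal (g a) := hg.ennreal_ofReal
  have hqm : Measurable fun a => ENNReal.ofReal (f a / g a) := (hf.div hg).ennreal_ofReal
  have h : (μ.withDensity fun a => ENNReal.ofReal (f a)) =
      (μ.withDensity fun a => ENNReal.ofReal (g a)).withDensity
        fun a => ENNReal.ofReal (f a / g a) := by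
    rw [← withDensity_mul μ hgm hqm]
    refine withDensity_congr_ae ?_
    filter_upwards [hfg] with a ha
    rw [Pi.mul_apply, ← ENNReal.ofReal_mul (hg0 a)]
    rcases eq_or_ne (g a) 0 with h0 | h0
    · simp [h0, ha h0]
    · rw [mul_div_cancel₀ _ h0]
  have hac : (μ.withDensity fun a => ENNReal.ofReal (f a)) ≪
      μ.withDensity fun a => ENNReal.ofReal (g a) := by
    rw [h]; exact withDensity_absolutelyContinuous _ _
  rw [InformationTheory.klDiv_eq_lintegral_klFun_of_ac hac]
  have hd := Measure.rnDeriv_withDensity (μ.withDensity fun a => ENNReal.ofReal (g a)) hqm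
  rw [← h] at hd
  have hm : Measurable fun a => ENNReal.ofReal (InformationTheory.klFun (f a / g a)) :=
    (InformationTheory.measurable_klFun.comp (hf.div hg)).ennreal_ofReal
  calc _ = ∫⁻ a, ENNReal.ofReal (InformationTheory.klFun (f a / g a))
        ∂(μ.withDensity fun a => ENNReal.ofReal (g a)) := by
        refine lintegral_congr_ae ?_
        filter_upwards [hd] with a ha
        rw [ha, ENNReal.toReal_ofReal (div_nonneg (hf0 a) (hg0 a))]
    _ = _ := by
        rw [lintegral_withDensity_eq_lintegral_mul _ hgm hm]
        refine lintegral_congr fun a => ?_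
        rw [Pi.mul_apply, ← ENNReal.ofReal_mul (hg0 a)]

/-- The output laws of the binary-input channel `W` have densities `1 + t` and `1 - t` with respect
to the probability measure `M` (their mean), and the law of `t` is symmetric. -/
structure SymmetricDensity {Y : Type*} [MeasurableSpace Y] (W : Kernel Bool Y) (M : Measure Y)
    (t : Y → ℝ) : Prop where
  isProbabilityMeasure : IsProbabilityMeasure M
  measurable : Measurable t
  abs_le_one : ∀ y, |t y| ≤ 1
  withDensity_false : W false = M.withDensity fun y => ENNReal.ofReal (1 + t y)
  withDensity_true : W true = M.withDensity fun y => ENNReal.ofReal (1 - t y)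
  map_neg : M.map (fun y => -t y) = M.map t

/-- The sign of a bit, `1` for `false` and `-1` for `true`. -/
noncomputable def bitSign (x : Bool) : ℝ := bif x then -1 else 1

namespace SymmetricDensity

variable {Y : Type*} [MeasurableSpace Y] {W : Kernel Bool Y} {M : Measure Y} {t : Y → ℝ}

theorem apply_eq (h : SymmetricDensity W M t) (x : Bool) :
    W x = M.withDensity fun y => ENNReal.ofReal (1 + bitSign x * t y) := by
  cases x
  · simpa [bitSign] using h.withDensity_false
  · simpa [bitSign, sub_eq_add_neg] using h.withDensity_true

theorem integrable_comp (h : SymmetricDensity W M t) {F : ℝ → ℝ} (hF : Continuous F) :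
    Integrable (fun y => F (t y)) M := by
  have := h.isProbabilityMeasure
  obtain ⟨C, hC⟩ := isCompact_Icc.exists_bound_of_continuousOn (hF.continuousOn (s := Set.Icc (-1) 1))
  exact Integrable.of_bound (hF.measurable.comp h.measurable).aestronglyMeasurable C
    (Filter.Eventually.of_forall fun y => hC _ (abs_le.1 (h.abs_le_one y)))

theorem integral_comp_neg (h : SymmetricDensity W M t) {F : ℝ → ℝ} (hF : Continuous F) :
    ∫ y, F (-t y) ∂M = ∫ y, F (t y) ∂M := by
  rw [← integral_map (φ := fun y => -t y) (f := F) h.measurable.neg.aemeasurable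
    hF.aestronglyMeasurable, h.map_neg,
    integral_map h.measurable.aemeasurable hF.aestronglyMeasurable]

theorem lintegral_comp_neg (h : SymmetricDensity W M t) {F : ℝ → ℝ≥0∞} (hF : Measurable F) :
    ∫⁻ y, F (-t y) ∂M = ∫⁻ y, F (t y) ∂M := by
  rw [← lintegral_map (g := fun y => -t y) hF h.measurable.neg, h.map_neg,
    lintegral_map hF h.measurable]

theorem integral_eq_zero (h : SymmetricDensity W M t) : ∫ y, t y ∂M = 0 := by
  have := h.integral_comp_neg continuous_id
  simp only [id, integral_neg] at this
  linarith

theorem isProbabilityMeasure_withDensity (h : SymmetricDensity W M t) {c : ℝ} (hc : |c| ≤ 1) :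
    IsProbabilityMeasure (M.withDensity fun y => ENNReal.ofReal (1 + c * t y)) := by
  have := h.isProbabilityMeasure
  refine ⟨?_⟩
  have hi : Integrable (fun y => 1 + c * t y) M :=
    h.integrable_comp (F := fun x => 1 + c * x) (by fun_prop)
  have h0 : ∀ y, 0 ≤ 1 + c * t y := fun y => by
    have : |c * t y| ≤ 1 := by
      rw [abs_mul]; exact mul_le_one₀ hc (abs_nonneg _) (h.abs_le_one y)
    linarith [(abs_le.1 this).1]
  rw [withDensity_apply _ MeasurableSet.univ, Measure.restrict_univ,
    ← ofReal_integral_eq_lintegral_ofReal hi (Filter.Eventually.of_forall h0),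
    integral_add (integrable_const _)
      (h.integrable_comp (F := fun x => c * x) (by fun_prop)), integral_const_mul,
    h.integral_eq_zero]
  simp

theorem isMarkovKernel (h : SymmetricDensity W M t) : IsMarkovKernel W :=
  ⟨fun x => by
    rw [h.apply_eq x]
    exact h.isProbabilityMeasure_withDensity (by cases x <;> simp [bitSign])⟩

/-- With respect to `p × M` the joint law has density `1 + bitSign x * t y`, and the product of the
marginals has density `1 + (a - b) * t y`, where `a` and `b` are the input probabilities. An
arbitrary `p` is needed because capacity is a supremum. -/
theorem mutualInformation_eq (h : SymmetricDensity W M t) (p : Measure Bool)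
    [IsProbabilityMeasure p] :
    mutualInformation p W = ENNReal.ofReal (∫ y,
      (p.real {false} * ((1 + t y) * Real.log (1 + t y))
        + p.real {true} * ((1 - t y) * Real.log (1 - t y))
        - (1 + (p.real {false} - p.real {true}) * t y)
          * Real.log (1 + (p.real {false} - p.real {true}) * t y)) ∂M) := by
  have := h.isProbabilityMeasure
  have := h.isMarkovKernel
  have htm := h.measurable
  set a := p.real {false} with ha
  set b := p.real {true} with hb
  have hab : a + b = 1 := by
    have := probReal_univ (μ := p)
    rw [← Finset.coe_univ, ← sum_measureReal_singleton] at this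
    simp only [Fintype.sum_bool] at this
    linarith
  have ha0 : 0 ≤ a := measureReal_nonneg
  have hb0 : 0 ≤ b := measureReal_nonneg
  have hfalse : p {false} = ENNReal.ofReal a := (ofReal_measureReal (measure_ne_top _ _)).symm
  have htrue : p {true} = ENNReal.ofReal b := (ofReal_measureReal (measure_ne_top _ _)).symm
  have hc : |a - b| ≤ 1 := abs_le.2 ⟨by linarith, by linarith⟩
  have nonneg : ∀ c : ℝ, |c| ≤ 1 → ∀ y, 0 ≤ 1 + c * t y := fun c hc y => by
    have : |c * t y| ≤ 1 := by
      rw [abs_mul]; exact mul_le_one₀ hc (abs_nonneg _) (h.abs_le_one y)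
    linarith [(abs_le.1 this).1]
  have hsign : ∀ x, |bitSign x| ≤ 1 := fun x => by cases x <;> simp [bitSign]
  have hfm : Measurable fun z : Bool × Y => 1 + bitSign z.1 * t z.2 := by
    have : Measurable bitSign := measurable_of_countable _
    fun_prop
  have joint : p.compProd W =
      (p.prod M).withDensity fun z => ENNReal.ofReal (1 + bitSign z.1 * t z.2) := by
    ext s hs
    rw [Measure.compProd_apply hs, withDensity_apply _ hs, ← lintegral_indicator hs,
      lintegral_prod _ ((hfm.ennreal_ofReal.indicator hs).aemeasurable)]
    refine lintegral_congr fun x => ?_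
    rw [h.apply_eq x, withDensity_apply _ (measurable_prodMk_left hs),
      ← lintegral_indicator (measurable_prodMk_left hs)]
    rfl
  have marginal : p.bind W = M.withDensity fun y => ENNReal.ofReal (1 + (a - b) * t y) := by
    have e : ∀ y, ENNReal.ofReal (1 + (a - b) * t y) =
        ENNReal.ofReal a * ENNReal.ofReal (1 + t y)
          + ENNReal.ofReal b * ENNReal.ofReal (1 - t y) := fun y => by
      obtain ⟨h1, h2⟩ := abs_le.1 (h.abs_le_one y)
      rw [← ENNReal.ofReal_mul ha0, ← ENNReal.ofReal_mul hb0,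
        ← ENNReal.ofReal_add (mul_nonneg ha0 (by linarith)) (mul_nonneg hb0 (by linarith))]
      congr 1
      linear_combination -hab
    ext s hs
    rw [Measure.bind_apply hs W.measurable.aemeasurable, lintegral_fintype,
      withDensity_apply _ hs]
    simp only [e]
    rw [lintegral_add_left (by fun_prop), lintegral_const_mul _ (by fun_prop),
      lintegral_const_mul _ (by fun_prop), Fintype.sum_bool, h.withDensity_false,
      h.withDensity_true, withDensity_apply _ hs, withDensity_apply _ hs, hfalse, htrue]
    ring
  have hgm : Measurable fun y => ENNReal.ofReal (1 + (a - b) * t y) := by fun_prop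
  have prod : p.prod (p.bind W) =
      (p.prod M).withDensity fun z => ENNReal.ofReal (1 + (a - b) * t z.2) := by
    rw [marginal]
    exact prod_withDensity_right hgm
  have i1 : IsFiniteMeasure
      ((p.prod M).withDensity fun z => ENNReal.ofReal (1 + bitSign z.1 * t z.2)) := by
    rw [← joint]; infer_instance
  have i2 : IsFiniteMeasure
      ((p.prod M).withDensity fun z => ENNReal.ofReal (1 + (a - b) * t z.2)) := by
    rw [← prod, marginal]
    have := h.isProbabilityMeasure_withDensity hc
    infer_instance
  have combine : ∀ y, a * (1 + t y) + b * (1 - t y) = 1 + (a - b) * t y := fun y => by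
    linear_combination hab
  -- `1 + (a - b) t` is the sum of the nonnegative terms `a (1 + t)` and `b (1 - t)`. This yields
  -- absolute continuity: the joint density vanishes wherever the product density does, for inputs
  -- of positive probability.
  have vanish : ∀ y, 1 + (a - b) * t y = 0 → (a = 0 ∨ 1 + t y = 0) ∧ (b = 0 ∨ 1 - t y = 0) := by
    intro y hy
    obtain ⟨h1, h2⟩ := abs_le.1 (h.abs_le_one y)
    have n1 : 0 ≤ a * (1 + t y) := mul_nonneg ha0 (by linarith)
    have n2 : 0 ≤ b * (1 - t y) := mul_nonneg hb0 (by linarith)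
    have := combine y
    exact ⟨mul_eq_zero.1 (by linarith), mul_eq_zero.1 (by linarith)⟩
  have hae : ∀ᵐ z ∂(p.prod M), 1 + (a - b) * t z.2 = 0 → 1 + bitSign z.1 * t z.2 = 0 := by
    have hs : MeasurableSet {z : Bool × Y |
        1 + (a - b) * t z.2 = 0 → 1 + bitSign z.1 * t z.2 = 0} := by
      have h1 : MeasurableSet {z : Bool × Y | 1 + (a - b) * t z.2 = 0} :=
        measurableSet_eq_fun (by fun_prop) measurable_const
      exact h1.imp (measurableSet_eq_fun hfm measurable_const)
    rw [Measure.ae_prod_iff_ae_ae hs, ae_iff_of_countable]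
    intro x hx
    refine Filter.Eventually.of_forall fun y hy => ?_
    obtain ⟨h1, h2⟩ := vanish y hy
    cases x
    · have : a ≠ 0 := fun h0 => hx (by rw [hfalse, h0, ENNReal.ofReal_zero])
      simpa [bitSign] using h1.resolve_left this
    · have : b ≠ 0 := fun h0 => hx (by rw [htrue, h0, ENNReal.ofReal_zero])
      simpa [bitSign, sub_eq_add_neg] using h2.resolve_left this
  rw [mutualInformation, joint, prod, klDiv_withDensity_ofReal (p.prod M) hfm (by fun_prop)
    (fun z => nonneg _ (hsign z.1) z.2) (fun z => nonneg _ hc z.2) hae]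
  set G : Bool → Y → ℝ := fun x y => (1 + (a - b) * t y) *
    InformationTheory.klFun ((1 + bitSign x * t y) / (1 + (a - b) * t y)) with hG
  have hGm : ∀ x, Measurable (G x) := fun x => by
    have := InformationTheory.measurable_klFun
    fun_prop
  have hG0 : ∀ x y, 0 ≤ G x y := fun x y => mul_nonneg (nonneg _ hc y)
    (InformationTheory.klFun_nonneg (div_nonneg (nonneg _ (hsign x) y) (nonneg _ hc y)))
  have hkm : Measurable fun z : Bool × Y => ENNReal.ofReal ((1 + (a - b) * t z.2) *
      InformationTheory.klFun ((1 + bitSign z.1 * t z.2) / (1 + (a - b) * t z.2))) := by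
    have := InformationTheory.measurable_klFun
    fun_prop
  have value : ∀ x y, (1 + (a - b) * t y = 0 → 1 + bitSign x * t y = 0) →
      G x y = (1 + bitSign x * t y) * Real.log (1 + bitSign x * t y)
        - (1 + bitSign x * t y) * Real.log (1 + (a - b) * t y)
        + (1 + (a - b) * t y) - (1 + bitSign x * t y) := by
    intro x y hy
    rw [hG]
    simp only [InformationTheory.klFun_apply]
    rcases eq_or_ne (1 + (a - b) * t y) 0 with h0 | h0
    · simp [h0, hy h0]
    · rcases eq_or_ne (1 + bitSign x * t y) 0 with h1 | h1
      · simp [h1]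
      · rw [Real.log_div h1 h0]
        field_simp
  have sumG : ∀ y, a * G false y + b * G true y = a * ((1 + t y) * Real.log (1 + t y))
      + b * ((1 - t y) * Real.log (1 - t y))
      - (1 + (a - b) * t y) * Real.log (1 + (a - b) * t y) := by
    intro y
    have v1 : a * G false y = a * ((1 + t y) * Real.log (1 + t y)
        - (1 + t y) * Real.log (1 + (a - b) * t y) + (1 + (a - b) * t y) - (1 + t y)) := by
      rcases eq_or_ne a 0 with h0 | h0
      · rw [h0]; ring
      · rw [value false y fun hy => by simpa [bitSign] using (vanish y hy).1.resolve_left h0]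
        simp [bitSign]
    have v2 : b * G true y = b * ((1 - t y) * Real.log (1 - t y)
        - (1 - t y) * Real.log (1 + (a - b) * t y) + (1 + (a - b) * t y) - (1 - t y)) := by
      rcases eq_or_ne b 0 with h0 | h0
      · rw [h0]; ring
      · rw [value true y fun hy => by
          simpa [bitSign, sub_eq_add_neg] using (vanish y hy).2.resolve_left h0]
        simp [bitSign, sub_eq_add_neg]
    rw [v1, v2]
    linear_combination (-Real.log (1 + (a - b) * t y) - 1) * combine y + (1 + (a - b) * t y) * hab
  have cont : Continuous fun x : ℝ => a * ((1 + x) * Real.log (1 + x))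
      + b * ((1 - x) * Real.log (1 - x)) - (1 + (a - b) * x) * Real.log (1 + (a - b) * x) := by
    have c1 : Continuous fun x : ℝ => (1 + x) * Real.log (1 + x) :=
      Real.continuous_mul_log.comp (by fun_prop : Continuous fun x : ℝ => 1 + x)
    have c2 : Continuous fun x : ℝ => (1 - x) * Real.log (1 - x) :=
      Real.continuous_mul_log.comp (by fun_prop : Continuous fun x : ℝ => 1 - x)
    have c3 : Continuous fun x : ℝ => (1 + (a - b) * x) * Real.log (1 + (a - b) * x) :=
      Real.continuous_mul_log.comp (by fun_prop : Continuous fun x : ℝ => 1 + (a - b) * x)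
    fun_prop
  rw [lintegral_prod _ hkm.aemeasurable, lintegral_fintype, Fintype.sum_bool, hfalse, htrue,
    ofReal_integral_eq_lintegral_ofReal (h.integrable_comp cont)
      (Filter.Eventually.of_forall fun y => by
        simp only [Pi.zero_apply]
        rw [← sumG y]
        exact add_nonneg (mul_nonneg ha0 (hG0 _ _)) (mul_nonneg hb0 (hG0 _ _)))]
  simp only [← sumG]
  simp only [fun y => ENNReal.ofReal_add (mul_nonneg ha0 (hG0 false y)) (mul_nonneg hb0 (hG0 true y)),
    ENNReal.ofReal_mul ha0, ENNReal.ofReal_mul hb0]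
  rw [lintegral_add_left ((hGm false).ennreal_ofReal.const_mul _),
    lintegral_const_mul _ (hGm false).ennreal_ofReal,
    lintegral_const_mul _ (hGm true).ennreal_ofReal]
  ring

theorem integral_bscInformation_eq (h : SymmetricDensity W M t) :
    ∫ y, (1 + t y) * Real.log (1 + t y) ∂M = ∫ y, bscInformation (t y) ∂M ∧
    ∫ y, (1 - t y) * Real.log (1 - t y) ∂M = ∫ y, bscInformation (t y) ∂M := by
  have c1 : Continuous fun x : ℝ => (1 + x) * Real.log (1 + x) :=
    Real.continuous_mul_log.comp (by fun_prop : Continuous fun x : ℝ => 1 + x)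
  have c2 : Continuous fun x : ℝ => (1 - x) * Real.log (1 - x) :=
    Real.continuous_mul_log.comp (by fun_prop : Continuous fun x : ℝ => 1 - x)
  have e := h.integral_comp_neg c1
  simp only [← sub_eq_add_neg] at e
  have : ∫ y, bscInformation (t y) ∂M = (∫ y, (1 + t y) * Real.log (1 + t y) ∂M
      + ∫ y, (1 - t y) * Real.log (1 - t y) ∂M) / 2 := by
    rw [← integral_add (h.integrable_comp c1) (h.integrable_comp c2), ← integral_div]
    rfl
  constructor <;> linarith

/-- By symmetry of `t`, the mutual information is the mean of `h(t)` minus that of `(1 + c t) log (1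
+ c t)`, with `c` the difference of the input probabilities. The latter mean is at least that of `c
t`, which is `0`, and it vanishes for uniform input. -/
theorem capacity_eq (h : SymmetricDensity W M t) :
    capacity W = (∫ y, bscInformation (t y) ∂M) / Real.log 2 := by
  have := h.isProbabilityMeasure
  obtain ⟨e1, e2⟩ := h.integral_bscInformation_eq
  have c1 : Continuous fun x : ℝ => (1 + x) * Real.log (1 + x) :=
    Real.continuous_mul_log.comp (by fun_prop : Continuous fun x : ℝ => 1 + x)
  have c2 : Continuous fun x : ℝ => (1 - x) * Real.log (1 - x) :=
    Real.continuous_mul_log.comp (by fun_prop : Continuous fun x : ℝ => 1 - x)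
  have hsup : (⨆ (p : Measure Bool) (_ : IsProbabilityMeasure p), mutualInformation p W) =
      ENNReal.ofReal (∫ y, bscInformation (t y) ∂M) := by
    refine le_antisymm (iSup₂_le fun p hp => ?_) ?_
    · rw [h.mutualInformation_eq p]
      refine ENNReal.ofReal_le_ofReal ?_
      set a := p.real {false} with ha
      set b := p.real {true} with hb
      have hab : a + b = 1 := by
        have := probReal_univ (μ := p)
        rw [← Finset.coe_univ, ← sum_measureReal_singleton] at this
        simp only [Fintype.sum_bool] at this
        linarith
      have ha0 : 0 ≤ a := measureReal_nonneg
      have hb0 : 0 ≤ b := measureReal_nonneg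
      have c3 : Continuous fun x : ℝ => (1 + (a - b) * x) * Real.log (1 + (a - b) * x) :=
        Real.continuous_mul_log.comp (by fun_prop : Continuous fun x : ℝ => 1 + (a - b) * x)
      have lower : 0 ≤ ∫ y, (1 + (a - b) * t y) * Real.log (1 + (a - b) * t y) ∂M := by
        calc (0 : ℝ) = ∫ y, (a - b) * t y ∂M := by
              rw [integral_const_mul, h.integral_eq_zero, mul_zero]
          _ ≤ _ := by
              refine integral_mono (h.integrable_comp (F := fun x => (a - b) * x) (by fun_prop))
                (h.integrable_comp c3) fun y => ?_
              obtain ⟨h1, h2⟩ := abs_le.1 (h.abs_le_one y)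
              have := sub_one_le_mul_log (x := 1 + (a - b) * t y) (by
                nlinarith [mul_nonneg ha0 (by linarith : 0 ≤ 1 + t y),
                  mul_nonneg hb0 (by linarith : 0 ≤ 1 - t y)])
              simp only
              linarith
      have hi : Integrable (fun y => a * ((1 + t y) * Real.log (1 + t y))
          + b * ((1 - t y) * Real.log (1 - t y))) M :=
        ((h.integrable_comp c1).const_mul a).add ((h.integrable_comp c2).const_mul b)
      rw [integral_sub hi (h.integrable_comp c3),
        integral_add ((h.integrable_comp c1).const_mul a) ((h.integrable_comp c2).const_mul b),
        integral_const_mul, integral_const_mul, e1, e2, ← add_mul, hab]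
      linarith
    · set p : Measure Bool := (2⁻¹ : ℝ≥0∞) • Measure.dirac false + (2⁻¹ : ℝ≥0∞) • Measure.dirac true
        with hp
      have hprob : IsProbabilityMeasure p := ⟨by simp [hp, ENNReal.inv_two_add_inv_two]⟩
      have hf : p.real {false} = 1 / 2 := by simp [hp, measureReal_def]
      have ht : p.real {true} = 1 / 2 := by simp [hp, measureReal_def]
      refine le_iSup₂_of_le p hprob ?_
      rw [h.mutualInformation_eq p, hf, ht]
      refine ENNReal.ofReal_le_ofReal (le_of_eq (integral_congr_ae
        (Filter.Eventually.of_forall fun y => ?_)))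
      simp [bscInformation]
      ring
  rw [capacity, hsup, ENNReal.toReal_ofReal]
  exact integral_nonneg fun y => bscInformation_nonneg (h.abs_le_one y)

end SymmetricDensity

/-! ### Every BMS channel has a symmetric density. -/

theorem withDensity_comp_map_equiv {α β : Type*} [MeasurableSpace α] [MeasurableSpace β]
    (μ : Measure α) (e : α ≃ᵐ β) {F : β → ℝ≥0∞} (hF : Measurable F) :
    (μ.withDensity fun a => F (e a)).map e = (μ.map e).withDensity F := by
  refine Measure.ext_of_lintegral _ fun φ hφ => ?_
  have hFe : Measurable fun a => F (e a) := hF.comp e.measurable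
  have hφe : Measurable fun a => φ (e a) := hφ.comp e.measurable
  rw [lintegral_map hφ e.measurable, lintegral_withDensity_eq_lintegral_mul _ hF hφ,
    lintegral_map (hF.mul hφ) e.measurable, lintegral_withDensity_eq_lintegral_mul _ hFe hφe]
  rfl

/-- The Radon-Nikodym densities of the output laws against their mean add up to `2`, so they are `1
+ t` and `1 - t`. The permutation preserves the mean and exchanges the densities, so it turns `t`
into `-t`. -/
theorem IsBMS.exists_symmetricDensity {Y : Type*} [MeasurableSpace Y] {W : Kernel Bool Y}
    (hW : IsBMS W) : ∃ (M : Measure Y) (t : Y → ℝ), SymmetricDensity W M t := by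
  have := hW.markov
  obtain ⟨e, h1, h2⟩ := hW.symmetric
  set M : Measure Y := (2⁻¹ : ℝ≥0∞) • (W false + W true) with hM
  have hMp : IsProbabilityMeasure M := ⟨by
    rw [hM, Measure.smul_apply, Measure.add_apply, measure_univ, measure_univ, one_add_one_eq_two,
      smul_eq_mul, ENNReal.inv_mul_cancel two_ne_zero ENNReal.ofNat_ne_top]⟩
  have hsum : W false + W true = M.withDensity fun _ => 2 := by
    rw [withDensity_const, hM, smul_smul, ENNReal.mul_inv_cancel two_ne_zero ENNReal.ofNat_ne_top,
      one_smul]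
  have hac : W false + W true ≪ M := by
    rw [hsum]; exact withDensity_absolutelyContinuous _ _
  have ac1 : W false ≪ M := (Measure.le_add_right le_rfl).absolutelyContinuous.trans hac
  have ac2 : W true ≪ M := (Measure.le_add_left le_rfl).absolutelyContinuous.trans hac
  set f := (W false).rnDeriv M with hf
  set g := (W true).rnDeriv M with hg
  have hfm : Measurable f := Measure.measurable_rnDeriv _ _
  have hgm : Measurable g := Measure.measurable_rnDeriv _ _
  have ef : M.withDensity f = W false := Measure.withDensity_rnDeriv_eq _ _ ac1
  have eg : M.withDensity g = W true := Measure.withDensity_rnDeriv_eq _ _ ac2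
  have hfg : f + g =ᵐ[M] fun _ => 2 := by
    rw [← withDensity_eq_iff_of_sigmaFinite (hfm.add hgm).aemeasurable aemeasurable_const,
      withDensity_add_left hfm, ef, eg, hsum]
  -- Clamping changes nothing almost everywhere, but makes `|t| ≤ 1` hold at every point.
  set t : Y → ℝ := fun y => max (-1) (min 1 ((f y).toReal - 1)) with ht
  have htm : Measurable t := by
    have := hfm.ennreal_toReal
    fun_prop
  have hval : ∀ᵐ y ∂M, ENNReal.ofReal (1 + t y) = f y ∧ ENNReal.ofReal (1 - t y) = g y := by
    filter_upwards [hfg] with y hy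
    simp only [Pi.add_apply] at hy
    have f2 : f y ≤ 2 := hy ▸ le_self_add
    have g2 : g y ≤ 2 := hy ▸ le_add_self
    have ft : f y ≠ ∞ := ne_top_of_le_ne_top ENNReal.ofNat_ne_top f2
    have gt : g y ≠ ∞ := ne_top_of_le_ne_top ENNReal.ofNat_ne_top g2
    have hs : (f y).toReal + (g y).toReal = 2 := by
      rw [← ENNReal.toReal_add ft gt, hy]; rfl
    have f0 : 0 ≤ (f y).toReal := ENNReal.toReal_nonneg
    have g0 : 0 ≤ (g y).toReal := ENNReal.toReal_nonneg
    have : t y = (f y).toReal - 1 := by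
      rw [ht]
      simp only
      rw [min_eq_right (by linarith), max_eq_right (by linarith)]
    rw [this, show 1 + ((f y).toReal - 1) = (f y).toReal by ring,
      show 1 - ((f y).toReal - 1) = (g y).toReal by linarith,
      ENNReal.ofReal_toReal ft, ENNReal.ofReal_toReal gt]
    exact ⟨rfl, rfl⟩
  have d1 : W false = M.withDensity fun y => ENNReal.ofReal (1 + t y) := by
    rw [← ef]; exact withDensity_congr_ae (hval.mono fun y hy => hy.1.symm)
  have d2 : W true = M.withDensity fun y => ENNReal.ofReal (1 - t y) := by
    rw [← eg]; exact withDensity_congr_ae (hval.mono fun y hy => hy.2.symm)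
  have habs : ∀ y, |t y| ≤ 1 := fun y =>
    abs_le.2 ⟨le_max_left _ _, max_le (by norm_num) (min_le_left _ _)⟩
  have hMe : M.map e = M := by
    rw [hM, Measure.map_smul, Measure.map_add _ _ e.measurable, h1, h2, add_comm]
  have hMe' : M.map e.symm = M := by
    conv_lhs => rw [← hMe]
    exact e.map_symm_map
  have hte : Measurable fun y => t (e.symm y) := htm.comp e.symm.measurable
  have hneg : (fun y => t (e.symm y)) =ᵐ[M] fun y => -t y := by
    have key : M.withDensity (fun y => ENNReal.ofReal (1 + t (e.symm y))) =
        M.withDensity fun y => ENNReal.ofReal (1 - t y) := by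
      rw [← d2, ← h1, d1]
      conv_lhs => rw [← hMe]
      rw [← withDensity_comp_map_equiv M e (F := fun y => ENNReal.ofReal (1 + t (e.symm y)))
        (hte.const_add 1).ennreal_ofReal]
      simp
    rw [withDensity_eq_iff_of_sigmaFinite
      (hte.const_add 1).ennreal_ofReal.aemeasurable
      (htm.const_sub 1).ennreal_ofReal.aemeasurable] at key
    filter_upwards [key] with y hy
    have b1 := abs_le.1 (habs y)
    have b2 := abs_le.1 (habs (e.symm y))
    rw [ENNReal.ofReal_eq_ofReal_iff (by linarith) (by linarith)] at hy
    linarith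
  refine ⟨M, t, hMp, htm, habs, d1, d2, ?_⟩
  rw [← Measure.map_congr hneg]
  change M.map (t ∘ e.symm) = _
  rw [← Measure.map_map htm e.symm.measurable, hMe']

/-! ### One bit sent through two independent channels. -/

namespace SymmetricDensity

variable {Y Z : Type*} [MeasurableSpace Y] [MeasurableSpace Z] {U : Kernel Bool Y}
  {W : Kernel Bool Z} {M : Measure Y} {N : Measure Z} {s : Y → ℝ} {t : Z → ℝ}

theorem integrable_comp_prod (hU : SymmetricDensity U M s) (hW : SymmetricDensity W N t)
    {F : ℝ × ℝ → ℝ} (hF : Continuous F) :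
    Integrable (fun q : Y × Z => F (s q.1, t q.2)) (M.prod N) := by
  have := hU.isProbabilityMeasure
  have := hW.isProbabilityMeasure
  have hs := hU.measurable
  have ht := hW.measurable
  obtain ⟨C, hC⟩ := (isCompact_Icc.prod isCompact_Icc).exists_bound_of_continuousOn
    (hF.continuousOn (s := Set.Icc (-1 : ℝ) 1 ×ˢ Set.Icc (-1 : ℝ) 1))
  refine Integrable.of_bound (hF.measurable.comp (by fun_prop)).aestronglyMeasurable C
    (Filter.Eventually.of_forall fun q => hC _ ⟨abs_le.1 (hU.abs_le_one q.1),
      abs_le.1 (hW.abs_le_one q.2)⟩)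

theorem abs_mul_le_one (hU : SymmetricDensity U M s) (hW : SymmetricDensity W N t) (q : Y × Z) :
    |s q.1 * t q.2| ≤ 1 := by
  rw [abs_mul]
  exact mul_le_one₀ (hU.abs_le_one _) (abs_nonneg _) (hW.abs_le_one _)

/-- Averaging over `t` and `-t` turns the integrand into `h(st)`; the left side is `I(Y₁; Y₂)` for
uniform input. -/
theorem integral_mul_log_prod (hU : SymmetricDensity U M s) (hW : SymmetricDensity W N t) :
    ∫ q, (1 + s q.1 * t q.2) * Real.log (1 + s q.1 * t q.2) ∂(M.prod N) =
      ∫ q, bscInformation (s q.1 * t q.2) ∂(M.prod N) := by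
  have := hU.isProbabilityMeasure
  have := hW.isProbabilityMeasure
  have c1 : Continuous fun x : ℝ × ℝ => (1 + x.1 * x.2) * Real.log (1 + x.1 * x.2) :=
    Real.continuous_mul_log.comp (by fun_prop : Continuous fun x : ℝ × ℝ => 1 + x.1 * x.2)
  have c2 : Continuous fun x : ℝ × ℝ => bscInformation (x.1 * x.2) :=
    continuous_bscInformation.comp (by fun_prop)
  rw [integral_prod _ (hU.integrable_comp_prod hW c1),
    integral_prod _ (hU.integrable_comp_prod hW c2)]
  refine integral_congr_ae (Filter.Eventually.of_forall fun y => ?_)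
  have c3 : Continuous fun x : ℝ => (1 + s y * x) * Real.log (1 + s y * x) :=
    Real.continuous_mul_log.comp (by fun_prop : Continuous fun x : ℝ => 1 + s y * x)
  have e := hW.integral_comp_neg c3
  have e' : ∀ x, bscInformation (s y * x) = ((1 + s y * x) * Real.log (1 + s y * x)
      + (1 + s y * -x) * Real.log (1 + s y * -x)) / 2 := fun x => by
    simp only [bscInformation, mul_neg, ← sub_eq_add_neg]
  simp only [e']
  rw [integral_div, integral_add (hW.integrable_comp c3)
    (hW.integrable_comp (F := fun x => (1 + s y * -x) * Real.log (1 + s y * -x))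
      (c3.comp continuous_neg)), e]
  ring

/-- The mean of `(1 + s)(1 + t)` and `(1 - s)(1 - t)` is `1 + st`, the density of the new base
measure; dividing by it gives the parameter `(s + t) / (1 + st)`. The equivalence `e` only relabels
pairs, as `r + 1`-tuples in the application. -/
theorem prod {X : Type*} [MeasurableSpace X] {V : Kernel Bool X} (hU : SymmetricDensity U M s)
    (hW : SymmetricDensity W N t) (e : Y × Z ≃ᵐ X)
    (hV : ∀ x, V x = ((U x).prod (W x)).map e) :
    SymmetricDensity V
      (((M.prod N).withDensity fun q => ENNReal.ofReal (1 + s q.1 * t q.2)).map e)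
      (fun x => (s (e.symm x).1 + t (e.symm x).2) / (1 + s (e.symm x).1 * t (e.symm x).2)) := by
  have := hU.isProbabilityMeasure
  have := hW.isProbabilityMeasure
  have hs := hU.measurable
  have ht := hW.measurable
  have hm : Measurable fun q : Y × Z => ENNReal.ofReal (1 + s q.1 * t q.2) := by fun_prop
  have htm : Measurable fun q : Y × Z => (s q.1 + t q.2) / (1 + s q.1 * t q.2) := by fun_prop
  have hte : Measurable fun x =>
      (s (e.symm x).1 + t (e.symm x).2) / (1 + s (e.symm x).1 * t (e.symm x).2) :=
    htm.comp e.symm.measurable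
  have nonneg : ∀ q : Y × Z, 0 ≤ 1 + s q.1 * t q.2 := fun q => by
    linarith [(abs_le.1 (hU.abs_mul_le_one hW q)).1]
  have zero : ∀ q : Y × Z, 1 + s q.1 * t q.2 = 0 →
      (1 + s q.1) * (1 + t q.2) = 0 ∧ (1 - s q.1) * (1 - t q.2) = 0 := fun q hq => by
    obtain ⟨h1, h2⟩ := abs_le.1 (hU.abs_le_one q.1)
    obtain ⟨h3, h4⟩ := abs_le.1 (hW.abs_le_one q.2)
    have n1 : 0 ≤ (1 + s q.1) * (1 + t q.2) := mul_nonneg (by linarith) (by linarith)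
    have n2 : 0 ≤ (1 - s q.1) * (1 - t q.2) := mul_nonneg (by linarith) (by linarith)
    constructor <;> linarith
  have factor : ∀ q : Y × Z,
      (1 + s q.1 * t q.2) * (1 + (s q.1 + t q.2) / (1 + s q.1 * t q.2)) =
        (1 + s q.1) * (1 + t q.2) ∧
      (1 + s q.1 * t q.2) * (1 - (s q.1 + t q.2) / (1 + s q.1 * t q.2)) =
        (1 - s q.1) * (1 - t q.2) := fun q => by
    rcases eq_or_ne (1 + s q.1 * t q.2) 0 with h | h
    · rw [(zero q h).1, (zero q h).2, h, zero_mul, zero_mul]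
      exact ⟨rfl, rfl⟩
    · constructor <;> · field_simp; ring
  refine ⟨⟨?_⟩, hte, fun x => ?_, ?_, ?_, ?_⟩
  · rw [Measure.map_apply e.measurable MeasurableSet.univ, Set.preimage_univ,
      withDensity_apply _ MeasurableSet.univ, Measure.restrict_univ,
      ← ofReal_integral_eq_lintegral_ofReal
        (hU.integrable_comp_prod hW (F := fun x => 1 + x.1 * x.2) (by fun_prop))
        (Filter.Eventually.of_forall nonneg),
      integral_add (integrable_const _)
        (hU.integrable_comp_prod hW (F := fun x => x.1 * x.2) (by fun_prop)),
      integral_prod_mul, hU.integral_eq_zero]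
    simp
  · obtain ⟨h1, h2⟩ := abs_le.1 (hU.abs_le_one (e.symm x).1)
    obtain ⟨h3, h4⟩ := abs_le.1 (hW.abs_le_one (e.symm x).2)
    rw [abs_div, abs_of_nonneg (nonneg (e.symm x))]
    refine div_le_one_of_le₀ (abs_le.2 ⟨?_, ?_⟩) (nonneg _)
    · nlinarith [mul_nonneg (neg_le_iff_add_nonneg.1 h1) (neg_le_iff_add_nonneg.1 h3)]
    · nlinarith [mul_nonneg (sub_nonneg.2 h2) (sub_nonneg.2 h4)]
  · rw [hV, hU.withDensity_false, hW.withDensity_false,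
      prod_withDensity (hs.const_add 1).ennreal_ofReal (ht.const_add 1).ennreal_ofReal,
      ← withDensity_comp_map_equiv _ e (hte.const_add 1).ennreal_ofReal]
    simp only [e.symm_apply_apply]
    rw [← withDensity_mul _ hm (htm.const_add 1).ennreal_ofReal]
    congr 2
    ext q
    rw [Pi.mul_apply, ← ENNReal.ofReal_mul (nonneg q), (factor q).1,
      ← ENNReal.ofReal_mul (by linarith [(abs_le.1 (hU.abs_le_one q.1)).1])]
  · rw [hV, hU.withDensity_true, hW.withDensity_true,
      prod_withDensity (hs.const_sub 1).ennreal_ofReal (ht.const_sub 1).ennreal_ofReal,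
      ← withDensity_comp_map_equiv _ e (hte.const_sub 1).ennreal_ofReal]
    simp only [e.symm_apply_apply]
    rw [← withDensity_mul _ hm (htm.const_sub 1).ennreal_ofReal]
    congr 2
    ext q
    rw [Pi.mul_apply, ← ENNReal.ofReal_mul (nonneg q), (factor q).2,
      ← ENNReal.ofReal_mul (by linarith [(abs_le.1 (hU.abs_le_one q.1)).2])]
  · refine Measure.ext_of_lintegral _ fun φ hφ => ?_
    rw [lintegral_map hφ hte.fun_neg, lintegral_map hφ hte,
      lintegral_map_equiv, lintegral_map_equiv]
    simp only [e.symm_apply_apply]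
    have k1 : Measurable fun q : Y × Z => φ (-((s q.1 + t q.2) / (1 + s q.1 * t q.2))) :=
      hφ.comp htm.fun_neg
    have k2 : Measurable fun q : Y × Z => φ ((s q.1 + t q.2) / (1 + s q.1 * t q.2)) :=
      hφ.comp htm
    rw [lintegral_withDensity_eq_lintegral_mul _ hm k1,
      lintegral_withDensity_eq_lintegral_mul _ hm k2]
    -- Changing both signs fixes `1 + ab` and negates the combined parameter, so symmetry of `s` and
    -- `t` separately suffices.
    set G : ℝ → ℝ → ℝ≥0∞ := fun a b =>
      ENNReal.ofReal (1 + a * b) * φ ((a + b) / (1 + a * b)) with hG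
    have hGm : Measurable fun z : ℝ × ℝ => G z.1 z.2 := by fun_prop
    have l : ∀ q : Y × Z, ENNReal.ofReal (1 + s q.1 * t q.2)
        * φ (-((s q.1 + t q.2) / (1 + s q.1 * t q.2))) = G (-s q.1) (-t q.2) := fun q => by
      simp only [hG, neg_mul_neg, ← neg_add, neg_div]
    simp only [Pi.mul_apply, l]
    have m1 : Measurable fun q : Y × Z => G (-s q.1) (-t q.2) :=
      hGm.comp (by fun_prop : Measurable fun q : Y × Z => (-s q.1, -t q.2))
    have m2 : Measurable fun q : Y × Z => G (s q.1) (t q.2) :=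
      hGm.comp (by fun_prop : Measurable fun q : Y × Z => (s q.1, t q.2))
    change ∫⁻ q : Y × Z, G (-s q.1) (-t q.2) ∂(M.prod N) = ∫⁻ q, G (s q.1) (t q.2) ∂(M.prod N)
    rw [lintegral_prod _ m1.aemeasurable, lintegral_prod _ m2.aemeasurable]
    have inner : ∀ a, ∫⁻ z, G a (-t z) ∂N = ∫⁻ z, G a (t z) ∂N := fun a =>
      hW.lintegral_comp_neg (F := G a) (hGm.comp measurable_prodMk_left)
    simp only [inner]
    refine hU.lintegral_comp_neg (F := fun a => ∫⁻ z, G a (t z) ∂N) ?_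
    have m3 : Measurable fun q : ℝ × Z => G q.1 (t q.2) :=
      hGm.comp (by fun_prop : Measurable fun q : ℝ × Z => (q.1, t q.2))
    exact m3.lintegral_prod_right'

theorem capacity_prod {X : Type*} [MeasurableSpace X] {V : Kernel Bool X}
    (hU : SymmetricDensity U M s) (hW : SymmetricDensity W N t) (e : Y × Z ≃ᵐ X)
    (hV : ∀ x, V x = ((U x).prod (W x)).map e) :
    capacity V = capacity U + capacity W
      - (∫ q, bscInformation (s q.1 * t q.2) ∂(M.prod N)) / Real.log 2 := by
  have := hU.isProbabilityMeasure
  have := hW.isProbabilityMeasure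
  have hs := hU.measurable
  have ht := hW.measurable
  have hm : Measurable fun q : Y × Z => ENNReal.ofReal (1 + s q.1 * t q.2) := by fun_prop
  have nonneg : ∀ q : Y × Z, 0 ≤ 1 + s q.1 * t q.2 := fun q => by
    linarith [(abs_le.1 (hU.abs_mul_le_one hW q)).1]
  rw [(hU.prod hW e hV).capacity_eq, hU.capacity_eq, hW.capacity_eq, ← add_div, ← sub_div]
  congr 1
  rw [integral_map_equiv]
  simp only [e.symm_apply_apply]
  rw [integral_withDensity_eq_integral_toReal_smul hm
    (Filter.Eventually.of_forall fun _ => ENNReal.ofReal_lt_top)]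
  simp only [ENNReal.toReal_ofReal (nonneg _), smul_eq_mul,
    mul_bscInformation_div (hU.abs_le_one _) (hW.abs_le_one _)]
  have cb := continuous_bscInformation
  have cψ : Continuous fun x : ℝ =>
      ((1 + x) * Real.log (1 + x) - (1 - x) * Real.log (1 - x)) / 2 := by
    have c1 : Continuous fun x : ℝ => (1 + x) * Real.log (1 + x) :=
      Real.continuous_mul_log.comp (by fun_prop : Continuous fun x : ℝ => 1 + x)
    have c2 : Continuous fun x : ℝ => (1 - x) * Real.log (1 - x) :=
      Real.continuous_mul_log.comp (by fun_prop : Continuous fun x : ℝ => 1 - x)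
    fun_prop
  have cl : Continuous fun x : ℝ × ℝ => (1 + x.1 * x.2) * Real.log (1 + x.1 * x.2) :=
    Real.continuous_mul_log.comp (by fun_prop : Continuous fun x : ℝ × ℝ => 1 + x.1 * x.2)
  set ψ : ℝ → ℝ := fun x =>
      ((1 + x) * Real.log (1 + x) - (1 - x) * Real.log (1 - x)) / 2 with hψ
  change ∫ q, (bscInformation (s q.1) + bscInformation (t q.2) + t q.2 * ψ (s q.1)
    + s q.1 * ψ (t q.2) - (1 + s q.1 * t q.2) * Real.log (1 + s q.1 * t q.2)) ∂(M.prod N) = _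
  have i1 := hU.integrable_comp_prod hW (F := fun x => bscInformation x.1) (by fun_prop)
  have i2 := hU.integrable_comp_prod hW (F := fun x => bscInformation x.2) (by fun_prop)
  have i3 := hU.integrable_comp_prod hW (F := fun x => x.2 * ψ x.1) (by fun_prop)
  have i4 := hU.integrable_comp_prod hW (F := fun x => x.1 * ψ x.2) (by fun_prop)
  have i12 := hU.integrable_comp_prod hW (F := fun x => bscInformation x.1 + bscInformation x.2)
    (by fun_prop)
  have i123 := hU.integrable_comp_prod hW
    (F := fun x => bscInformation x.1 + bscInformation x.2 + x.2 * ψ x.1) (by fun_prop)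
  have i1234 := hU.integrable_comp_prod hW
    (F := fun x => bscInformation x.1 + bscInformation x.2 + x.2 * ψ x.1 + x.1 * ψ x.2)
    (by fun_prop)
  rw [integral_sub i1234 (hU.integrable_comp_prod hW cl), integral_add i123 i4,
    integral_add i12 i3, integral_add i1 i2, hU.integral_mul_log_prod hW,
    integral_fun_fst (fun y => bscInformation (s y)),
    integral_fun_snd (fun z => bscInformation (t z))]
  -- The cross terms factor by independence and vanish because `s` and `t` have mean zero.
  simp only [fun q : Y × Z => mul_comm (t q.2) (ψ (s q.1))]
  rw [integral_prod_mul (fun y => ψ (s y)) t, integral_prod_mul s (fun z => ψ (t z)),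
    hU.integral_eq_zero, hW.integral_eq_zero]
  simp

theorem capacity_mem_Icc (h : SymmetricDensity U M s) : 0 ≤ capacity U ∧ capacity U ≤ 1 := by
  have := h.isProbabilityMeasure
  have hl : 0 < Real.log 2 := Real.log_pos one_lt_two
  rw [h.capacity_eq]
  refine ⟨div_nonneg (integral_nonneg fun y => bscInformation_nonneg (h.abs_le_one y)) hl.le,
    (div_le_one hl).2 ?_⟩
  calc ∫ y, bscInformation (s y) ∂M ≤ ∫ _, Real.log 2 ∂M :=
        integral_mono (h.integrable_comp continuous_bscInformation) (integrable_const _)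
          fun y => bscInformation_le_log_two (h.abs_le_one y)
    _ = Real.log 2 := by simp

/-- Among pairs of symmetric channels of given capacities, erasure channels combine to the
largest capacity. -/
theorem capacity_prod_le {X : Type*} [MeasurableSpace X] {V : Kernel Bool X}
    (hU : SymmetricDensity U M s) (hW : SymmetricDensity W N t) (e : Y × Z ≃ᵐ X)
    (hV : ∀ x, V x = ((U x).prod (W x)).map e) :
    (1 - capacity U) * (1 - capacity W) ≤ 1 - capacity V := by
  have := hU.isProbabilityMeasure
  have := hW.isProbabilityMeasure
  have hl : 0 < Real.log 2 := Real.log_pos one_lt_two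
  have cb := continuous_bscInformation
  have key : (∫ y, bscInformation (s y) ∂M) * ∫ z, bscInformation (t z) ∂N ≤
      Real.log 2 * ∫ q, bscInformation (s q.1 * t q.2) ∂(M.prod N) := by
    rw [← integral_prod_mul (fun y => bscInformation (s y)) (fun z => bscInformation (t z)),
      ← integral_const_mul]
    exact integral_mono
      (hU.integrable_comp_prod hW (F := fun x => bscInformation x.1 * bscInformation x.2)
        (by fun_prop))
      (hU.integrable_comp_prod hW (F := fun x => Real.log 2 * bscInformation (x.1 * x.2))
        (by fun_prop)) fun q => bscInformation_mul_le (hU.abs_le_one _) (hW.abs_le_one _)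
  have : capacity U * capacity W ≤
      (∫ q, bscInformation (s q.1 * t q.2) ∂(M.prod N)) / Real.log 2 := by
    rw [hU.capacity_eq, hW.capacity_eq, div_mul_div_comm, div_le_div_iff₀ (by positivity) hl]
    nlinarith
  rw [hU.capacity_prod hW e hV]
  linarith

/-- `h(s) h(t) = log 2 * h(st)` when `s` is `0` or `±1`, because `h` is even with `h 0 = 0` and `h 1
= log 2`. -/
theorem capacity_prod_erasure {X : Type*} [MeasurableSpace X] {V : Kernel Bool X}
    (hU : SymmetricDensity U M s) (hW : SymmetricDensity W N t) (e : Y × Z ≃ᵐ X)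
    (hV : ∀ x, V x = ((U x).prod (W x)).map e) (hs : ∀ y, s y = 0 ∨ |s y| = 1) :
    1 - capacity V = (1 - capacity U) * (1 - capacity W) := by
  have := hU.isProbabilityMeasure
  have := hW.isProbabilityMeasure
  have hl : Real.log 2 ≠ 0 := (Real.log_pos one_lt_two).ne'
  have key : (∫ y, bscInformation (s y) ∂M) * ∫ z, bscInformation (t z) ∂N =
      Real.log 2 * ∫ q, bscInformation (s q.1 * t q.2) ∂(M.prod N) := by
    rw [← integral_prod_mul (fun y => bscInformation (s y)) (fun z => bscInformation (t z)),
      ← integral_const_mul]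
    refine integral_congr_ae (Filter.Eventually.of_forall fun q => ?_)
    rcases hs q.1 with h | h
    · simp [h, bscInformation_zero]
    · rcases eq_or_eq_neg_of_abs_eq h with h | h <;>
        simp [h, bscInformation_neg, bscInformation_one]
  rw [hU.capacity_prod hW e hV, hU.capacity_eq, hW.capacity_eq]
  field_simp
  linarith

end SymmetricDensity

/-! ### Capacity of the repetition channel. -/

theorem repetitionChannel_succ {Y : Type*} [MeasurableSpace Y] (W : Kernel Bool Y)
    [IsMarkovKernel W] (r : ℕ) (x : Bool) :
    repetitionChannel W (r + 1) x = ((W x).prod (repetitionChannel W r x)).map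
      (MeasurableEquiv.piFinSuccAbove (fun _ : Fin (r + 1) => Y) 0).symm :=
  ((measurePreserving_piFinSuccAbove (fun _ : Fin (r + 1) => W x) 0).symm _).map_eq.symm

theorem symmetricDensity_repetitionChannel_zero {Y : Type*} [MeasurableSpace Y]
    (W : Kernel Bool Y) :
    SymmetricDensity (repetitionChannel W 0) (Measure.dirac fun i => i.elim0) fun _ => 0 where
  isProbabilityMeasure := inferInstance
  measurable := measurable_const
  abs_le_one := by simp
  withDensity_false := by
    simp only [add_zero, ENNReal.ofReal_one, withDensity_const, one_smul]
    exact Measure.pi_of_empty _ _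
  withDensity_true := by
    simp only [sub_zero, ENNReal.ofReal_one, withDensity_const, one_smul]
    exact Measure.pi_of_empty _ _
  map_neg := by simp

namespace SymmetricDensity

variable {Y : Type*} [MeasurableSpace Y] {W : Kernel Bool Y} {M : Measure Y} {t : Y → ℝ}

theorem capacity_repetitionChannel_zero (W : Kernel Bool Y) :
    capacity (repetitionChannel W 0) = 0 := by
  rw [(symmetricDensity_repetitionChannel_zero W).capacity_eq]
  simp [bscInformation_zero]

theorem capacity_repetitionChannel_one (h : SymmetricDensity W M t) :
    capacity (repetitionChannel W 1) = capacity W := by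
  have := h.isMarkovKernel
  rw [h.capacity_prod (symmetricDensity_repetitionChannel_zero W) _ (repetitionChannel_succ W 0),
    capacity_repetitionChannel_zero]
  simp [bscInformation_zero]

/-- Both claims go through one induction, since the product inequality at each step needs a
symmetric density for `W^r`. -/
theorem exists_repetitionChannel (h : SymmetricDensity W M t) (r : ℕ) :
    (∃ M' t', SymmetricDensity (repetitionChannel W r) M' t') ∧
      (1 - capacity W) ^ r ≤ 1 - capacity (repetitionChannel W r) := by
  have := h.isMarkovKernel
  induction r with
  | zero =>
    exact ⟨⟨_, _, symmetricDensity_repetitionChannel_zero W⟩,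
      by simp [capacity_repetitionChannel_zero]⟩
  | succ r ih =>
    obtain ⟨⟨M', t', h'⟩, hr⟩ := ih
    refine ⟨⟨_, _, h.prod h' _ (repetitionChannel_succ W r)⟩, ?_⟩
    rw [pow_succ']
    exact (mul_le_mul_of_nonneg_left hr (sub_nonneg.2 h.capacity_mem_Icc.2)).trans
      (h.capacity_prod_le h' _ (repetitionChannel_succ W r))

theorem capacity_repetitionChannel_le (h : SymmetricDensity W M t) (r : ℕ) :
    capacity (repetitionChannel W r) ≤ 1 - (1 - capacity W) ^ r := by
  linarith [(h.exists_repetitionChannel r).2]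

theorem capacity_repetitionChannel_erasure (h : SymmetricDensity W M t)
    (ht : ∀ y, t y = 0 ∨ |t y| = 1) (r : ℕ) :
    capacity (repetitionChannel W r) = 1 - (1 - capacity W) ^ r := by
  have := h.isMarkovKernel
  induction r with
  | zero => simp [capacity_repetitionChannel_zero]
  | succ r ih =>
    obtain ⟨⟨M', t', h'⟩, -⟩ := h.exists_repetitionChannel r
    have := h.capacity_prod_erasure h' _ (repetitionChannel_succ W r) ht
    rw [ih] at this
    rw [pow_succ']
    linarith

end SymmetricDensity

/-! ### The erasure channel. -/

/-- The sign of an output of the erasure channel, `0` for an erasure. -/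
noncomputable def erasureSign (y : Option Bool) : ℝ := y.elim 0 bitSign

instance : MeasurableSingletonClass (Option Bool) := ⟨fun _ => trivial⟩

theorem symmetricDensity_BEC {ε : ℝ} (h0 : 0 ≤ ε) (h1 : ε ≤ 1) :
    SymmetricDensity (BEC ε) (ENNReal.ofReal ε • Measure.dirac none +
      ENNReal.ofReal ((1 - ε) / 2) •
        (Measure.dirac (some false) + Measure.dirac (some true))) erasureSign where
  isProbabilityMeasure := ⟨by
    have e : 0 ≤ (1 - ε) / 2 := by linarith
    simp only [Measure.add_apply, Measure.smul_apply, measure_univ, smul_eq_mul, mul_one]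
    rw [mul_add, mul_one, ← ENNReal.ofReal_add e e, ← ENNReal.ofReal_add h0 (by linarith)]
    ring_nf
    simp⟩
  measurable := measurable_of_countable _
  abs_le_one := fun y => by
    rcases y with _ | _ | _ <;> simp [erasureSign, bitSign]
  withDensity_false := by
    simp only [withDensity_add_measure, withDensity_smul_measure, dirac_withDensity]
    simp only [erasureSign, bitSign, Option.elim, cond_true, cond_false, smul_add, smul_smul]
    rw [← ENNReal.ofReal_mul h0, ← ENNReal.ofReal_mul (by linarith),
      ← ENNReal.ofReal_mul (by linarith), show (1 - ε) / 2 * (1 + 1) = 1 - ε by ring]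
    simp [BEC]
  withDensity_true := by
    simp only [withDensity_add_measure, withDensity_smul_measure, dirac_withDensity]
    simp only [erasureSign, bitSign, Option.elim, cond_true, cond_false, smul_add, smul_smul]
    rw [← ENNReal.ofReal_mul h0, ← ENNReal.ofReal_mul (by linarith),
      ← ENNReal.ofReal_mul (by linarith), show (1 - ε) / 2 * (1 - -1) = 1 - ε by ring]
    simp [BEC]
  map_neg := by
    have m1 : Measurable erasureSign := measurable_of_countable _
    have m2 : Measurable fun y => -erasureSign y := measurable_of_countable _
    simp only [Measure.map_add _ _ m1, Measure.map_add _ _ m2, Measure.map_smul,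
      Measure.map_dirac' m1, Measure.map_dirac' m2]
    simp only [erasureSign, bitSign, Option.elim, cond_true, cond_false, neg_zero, neg_neg]
    rw [add_comm (Measure.dirac (-1 : ℝ))]

theorem erasureSign_eq (y : Option Bool) : erasureSign y = 0 ∨ |erasureSign y| = 1 := by
  rcases y with _ | _ | _ <;> simp [erasureSign, bitSign]

theorem capacity_BEC {ε : ℝ} (h0 : 0 ≤ ε) (h1 : ε ≤ 1) : capacity (BEC ε) = 1 - ε := by
  have hl : Real.log 2 ≠ 0 := (Real.log_pos one_lt_two).ne'
  have h := symmetricDensity_BEC h0 h1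
  have := h.isProbabilityMeasure
  rw [h.capacity_eq, integral_add_measure (h.integrable_comp continuous_bscInformation).left_of_add_measure
    (h.integrable_comp continuous_bscInformation).right_of_add_measure, integral_smul_measure,
    integral_smul_measure, integral_add_measure (integrable_dirac (by simp)) (integrable_dirac (by simp))]
  simp only [integral_dirac, erasureSign, bitSign, Option.elim, cond_true, cond_false,
    bscInformation_zero, bscInformation_neg, bscInformation_one, smul_eq_mul]
  rw [ENNReal.toReal_ofReal (show 0 ≤ (1 - ε) / 2 by linarith)]
  field_simp
  ring

/-- Flipping the unerased outputs of the erasure channel. -/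
def erasureFlip : Option Bool ≃ᵐ Option Bool where
  toEquiv := Equiv.optionCongr Equiv.boolNot
  measurable_toFun := measurable_of_countable _
  measurable_invFun := measurable_of_countable _

theorem isBMS_BEC {ε : ℝ} (h0 : 0 ≤ ε) (h1 : ε ≤ 1) : IsBMS (BEC ε) where
  markov := (symmetricDensity_BEC h0 h1).isMarkovKernel
  symmetric := by
    refine ⟨erasureFlip, ?_, ?_⟩ <;>
    · simp only [BEC, Kernel.coe_mk, Measure.map_add _ _ erasureFlip.measurable, Measure.map_smul,
        Measure.map_dirac' erasureFlip.measurable]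
      rfl

/-! ### The one-variable estimate. -/

/-- If the mean of `exp (-·)` over `[0, x]` is at least `b`, then `x` is at most
`2 (1 - b) / b ^ 2`. -/
theorem mul_sq_le_of_mul_le_one_sub_exp {b x : ℝ} (hb : 0 ≤ b) (hx : 0 < x)
    (h : b * x ≤ 1 - Real.exp (-x)) : b ^ 2 * x ≤ 2 * (1 - b) := by
  -- With `u = exp (-x)` this says `(1 - u) ^ 2 ≤ 2 (x - (1 - u))`, and the hypothesis bounds the
  -- right side by `2 (1 - b) x`. The expression vanishes at `0` and has derivative `2 (1 - u) ^ 2`.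
  have key : 0 ≤ 2 * x - 3 + 4 * Real.exp (-x) - Real.exp (-x) ^ 2 := by
    have mono : Monotone fun y : ℝ => 2 * y - 3 + 4 * Real.exp (-y) - Real.exp (-y) ^ 2 := by
      have hd : ∀ y, HasDerivAt
          (fun y : ℝ => 2 * y - 3 + 4 * Real.exp (-y) - Real.exp (-y) ^ 2)
          (2 * (1 - Real.exp (-y)) ^ 2) y := fun y => by
        have he : HasDerivAt (fun y : ℝ => Real.exp (-y)) (-Real.exp (-y)) y := by
          simpa using (hasDerivAt_neg y).exp
        have h := ((((hasDerivAt_id y).const_mul 2).sub_const 3).add (he.const_mul 4)).sub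
          (he.fun_pow 2)
        refine HasDerivAt.congr_deriv (f := fun y : ℝ =>
          2 * y - 3 + 4 * Real.exp (-y) - Real.exp (-y) ^ 2) h ?_
        push_cast
        ring
      exact monotone_of_hasDerivAt_nonneg hd fun y => by positivity
    have := mono hx.le
    norm_num at this
    linarith
  set u := Real.exp (-x)
  have h1 : (b * x) ^ 2 ≤ (1 - u) ^ 2 := pow_le_pow_left₀ (by positivity) h 2
  have h2 : (b ^ 2 * x) * x ≤ (2 * (1 - b)) * x := by nlinarith
  exact le_of_mul_le_mul_right h2 hx

/-- The bound on the repetition lengths `r` admissible for the erasure channel of capacity `C`. -/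
theorem repetition_bound {C β : ℝ} {r : ℕ} (hC : 0 ≤ C) (hβ : 0 ≤ β) (hβ1 : β < 1)
    (h : β * (r * C) ≤ 1 - (1 - C) ^ r) :
    β ^ 2 * (r * C) * (1 - 4 / (1 - β) * C) ≤ 2 * (1 - β) := by
  have hδ : 0 < 1 - β := by linarith
  have hx0 : 0 ≤ β ^ 2 * (r * C) := by positivity
  set y := C / (1 - β) with hy
  have hy0 : 0 ≤ y := by positivity
  have hCy : C = y * (1 - β) := by rw [hy]; field_simp
  rw [show 4 / (1 - β) * C = 4 * y by rw [hy]; ring]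
  -- If `4 y ≥ 1`, the left side is nonpositive. Otherwise `C ≤ y < 1 / 4`, so the logarithm below
  -- is defined.
  rcases le_or_gt 1 (4 * y) with h4 | h4
  · nlinarith [mul_nonneg hx0 (sub_nonneg.2 h4)]
  have hCy' : C ≤ y := by rw [hCy]; nlinarith
  have hC1 : 0 < 1 - C := by linarith
  -- Chosen so that `exp (-x) = (1 - C) ^ r`; then `r C ≤ x ≤ r C / (1 - C)`.
  set x := -(r * Real.log (1 - C)) with hx
  have hexp : Real.exp (-x) = (1 - C) ^ r := by
    rw [hx, neg_neg, ← Real.log_pow, Real.exp_log (by positivity)]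
  have hxl : r * C ≤ x := by
    have := Real.log_le_sub_one_of_pos hC1
    rw [hx, ← mul_neg]
    exact mul_le_mul_of_nonneg_left (by linarith) (Nat.cast_nonneg r)
  have hxu : (1 - C) * x ≤ r * C := by
    have := Real.one_sub_inv_le_log_of_pos hC1
    have : (1 - C) * -Real.log (1 - C) ≤ C := by
      have h3 := mul_le_mul_of_nonneg_left this hC1.le
      rw [mul_sub, mul_inv_cancel₀ hC1.ne'] at h3
      linarith
    calc (1 - C) * x = r * ((1 - C) * -Real.log (1 - C)) := by rw [hx]; ring
      _ ≤ r * C := mul_le_mul_of_nonneg_left this (Nat.cast_nonneg r)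
  rcases hx0.eq_or_lt with hz | hz
  · rw [← hz, zero_mul]; linarith
  have hx00 : 0 < x :=
    (pos_of_mul_pos_right hz (sq_nonneg β)).trans_le hxl
  -- Shrinking `β` to `β (1 - C)` absorbs the replacement of `r C` by `x`.
  have main := mul_sq_le_of_mul_le_one_sub_exp (b := β * (1 - C)) (x := x) (by positivity) hx00
    (by rw [hexp]; nlinarith)
  -- Here `1 - β (1 - C) ≤ (1 - β) + C = (1 - β)(1 + y)`.
  have m2 : β ^ 2 * (r * C) * (1 - C) ^ 2 ≤ 2 * ((1 - β) * (1 + y)) := by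
    have : β ^ 2 * (r * C) * (1 - C) ^ 2 ≤ β ^ 2 * x * (1 - C) ^ 2 := by gcongr
    have : β * C ≤ C := by nlinarith
    nlinarith
  have m3 : β ^ 2 * (r * C) * (1 - y) ^ 2 ≤ 2 * ((1 - β) * (1 + y)) := by
    refine le_trans ?_ m2
    gcongr
    linarith
  have hy1 : 0 < (1 - y) ^ 2 := by
    have : 0 < 1 - y := by linarith
    positivity
  refine le_of_mul_le_mul_right ?_ hy1
  calc β ^ 2 * (r * C) * (1 - 4 * y) * (1 - y) ^ 2
      = β ^ 2 * (r * C) * (1 - y) ^ 2 * (1 - 4 * y) := by ring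
    _ ≤ 2 * ((1 - β) * (1 + y)) * (1 - 4 * y) :=
        mul_le_mul_of_nonneg_right m3 (by linarith)
    _ = 2 * (1 - β) * ((1 + y) * (1 - 4 * y)) := by ring
    _ ≤ 2 * (1 - β) * (1 - y) ^ 2 := by
        refine mul_le_mul_of_nonneg_left ?_ (by linarith)
        -- The constant `4` enters through `(1 + y)(1 - 4 y) ≤ (1 - y) ^ 2` for `y ≥ 0`.
        nlinarith

/-! ### Largest repetition lengths and the theorem. -/

theorem mul_le_capacity_of_mem_admissibleLengths {D : Set ℕ} {n r : ℕ} {β : ℝ} {Y : Type*}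
    [MeasurableSpace Y] {W : Kernel Bool Y} (hn : 1 ≤ n) (h : r ∈ admissibleLengths D n β W) :
    β * (r * capacity W) ≤ capacity (repetitionChannel W r) := by
  obtain ⟨-, hr, h⟩ := h
  have hn0 : (0 : ℝ) < n := by exact_mod_cast hn
  have hr0 : (0 : ℝ) < r := by exact_mod_cast hr
  refine le_of_mul_le_mul_left ?_ (div_pos hn0 hr0)
  refine le_trans (le_of_eq ?_) h
  field_simp

/-- Length `1` is admissible because `W^1` has the capacity of `W`. For infinite `D`, lengths stay
bounded because `β r C ≤ C(W^r) ≤ 1`. -/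
theorem IsBMS.exists_isLargestRepetition {D : Set ℕ} {n : ℕ} {β : ℝ} {Y : Type*}
    [MeasurableSpace Y] {W : Kernel Bool Y} (hW : IsBMS W) (hn : 1 ≤ n) (hβ : β ≤ 1)
    (h1 : 1 ∈ D) (hD : D.Finite ∨ 0 < β * capacity W) :
    ∃ r, IsLargestRepetition D n β W r := by
  obtain ⟨M, t, h⟩ := hW.exists_symmetricDensity
  have hne : (admissibleLengths D n β W).Nonempty := by
    refine ⟨1, h1, le_rfl, ?_⟩
    rw [h.capacity_repetitionChannel_one, Nat.cast_one, div_one]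
    exact mul_le_of_le_one_left (mul_nonneg (Nat.cast_nonneg n) h.capacity_mem_Icc.1) hβ
  have hbdd : BddAbove (admissibleLengths D n β W) := by
    rcases hD with hD | hD
    · exact hD.bddAbove.mono fun r hr => hr.1
    · refine ⟨⌈1 / (β * capacity W)⌉₊, fun r hr => ?_⟩
      obtain ⟨⟨M', t', h'⟩, -⟩ := h.exists_repetitionChannel r
      have := (mul_le_capacity_of_mem_admissibleLengths hn hr).trans h'.capacity_mem_Icc.2
      have hle : (r : ℝ) ≤ 1 / (β * capacity W) := by
        rw [le_div_iff₀ hD]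
        linarith
      exact_mod_cast hle.trans (Nat.le_ceil _)
  exact ⟨_, Nat.sSup_mem hne hbdd, fun r hr => le_csSup hbdd hr⟩

theorem mainTheorem7 :
    -- among the BMS channels of a given capacity, the BEC has the largest repetition length
    (∀ {Y : Type*} [MeasurableSpace Y] (W : Kernel Bool Y), IsBMS W →
      (0 ≤ capacity W ∧ capacity W ≤ 1) ∧
      IsBMS (BEC (1 - capacity W)) ∧ capacity (BEC (1 - capacity W)) = capacity W ∧
      ∀ (D : Set ℕ) (n : ℕ) (β : ℝ), 1 ≤ n → 0 ≤ β → β ≤ 1 →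
        -- the largest repetition lengths exist
        (1 ∈ D → (D.Finite ∨ 0 < β * capacity W) →
          (∃ r, IsLargestRepetition D n β W r) ∧
          ∃ r, IsLargestRepetition D n β (BEC (1 - capacity W)) r) ∧
        ∀ r r' : ℕ, IsLargestRepetition D n β W r →
          IsLargestRepetition D n β (BEC (1 - capacity W)) r' → r ≤ r') ∧
    -- the bound for an arbitrary BMS channel, with an absolute constant `K`
    ∃ K : ℝ, 0 < K ∧
      ∀ {Y : Type*} [MeasurableSpace Y] (W : Kernel Bool Y), IsBMS W →
        ∀ (D : Set ℕ) (n : ℕ) (β : ℝ), 1 ≤ n → 0 ≤ β → β < 1 →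
          ∀ r : ℕ, IsLargestRepetition D n β W r →
            (n * capacity W) / (2 * (1 - β)) * β ^ 2 * (1 - K / (1 - β) * capacity W)
              ≤ (n : ℝ) / r := by
  refine ⟨?_, 4, by norm_num, ?_⟩
  · intro Y _ W hW
    obtain ⟨M, t, h⟩ := hW.exists_symmetricDensity
    obtain ⟨c0, c1⟩ := h.capacity_mem_Icc
    have e0 : 0 ≤ 1 - capacity W := by linarith
    have e1 : 1 - capacity W ≤ 1 := by linarith
    have hE := isBMS_BEC e0 e1
    have hcap : capacity (BEC (1 - capacity W)) = capacity W := by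
      rw [capacity_BEC e0 e1, sub_sub_cancel]
    refine ⟨⟨c0, c1⟩, hE, hcap, fun D n β hn hβ hβ1 => ⟨fun h1 hD => ?_, fun r r' hr hr' => ?_⟩⟩
    · refine ⟨hW.exists_isLargestRepetition hn hβ1 h1 hD,
        hE.exists_isLargestRepetition hn hβ1 h1 (by rwa [hcap])⟩
    -- It suffices that `r` is admissible for the BEC, whose repetition capacity is the upper bound
    -- for that of `W`.
    · refine hr'.2 ⟨hr.1.1, hr.1.2.1, ?_⟩
      rw [hcap]
      refine hr.1.2.2.trans ?_
      refine mul_le_mul_of_nonneg_left ?_ (by positivity)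
      rw [(symmetricDensity_BEC e0 e1).capacity_repetitionChannel_erasure erasureSign_eq, hcap]
      exact h.capacity_repetitionChannel_le r
  · intro Y _ W hW D n β hn hβ hβ1 r hr
    obtain ⟨M, t, h⟩ := hW.exists_symmetricDensity
    have hn0 : (0 : ℝ) < n := by exact_mod_cast hn
    have hr0 : (0 : ℝ) < r := by exact_mod_cast hr.1.2.1
    have hδ : 0 < 1 - β := by linarith
    have adm : β * (r * capacity W) ≤ 1 - (1 - capacity W) ^ r :=
      (mul_le_capacity_of_mem_admissibleLengths hn hr.1).trans (h.capacity_repetitionChannel_le r)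
    have := repetition_bound h.capacity_mem_Icc.1 hβ hβ1 adm
    rw [le_div_iff₀ hr0]
    calc n * capacity W / (2 * (1 - β)) * β ^ 2 * (1 - 4 / (1 - β) * capacity W) * r
        = n / (2 * (1 - β)) *
          (β ^ 2 * (r * capacity W) * (1 - 4 / (1 - β) * capacity W)) := by ring
      _ ≤ n / (2 * (1 - β)) * (2 * (1 - β)) := by gcongr
      _ = n := by field_simp
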